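/- Let $\xi_1,\xi_2,\ldots$ be independent real-valued random variables on a probability space, and let $\eta$ be a random variable with values in $\{0,1,2,\ldots\}$, not almost surely equal to $0$, and independent of the sequence $(\xi_1,\xi_2,\ldots)$. For a random variable $X$ let $F_X(x)=\mathbb{P}(X\le x)$ be its distribution function, and for a distribution function $F$ write $\overline F(x)=1-F(x)$. Say that $F$ has a consistently varying tail, $F\in\mathcal{C}$, if $\overline F(x)>0$ for all $x\in\mathbb{R}$ and \[ \lim_{y\uparrow 1}\ \limsup_{x\to\infty}\frac{\overline F(xy)}{\overline F(x)}=1, \] and define the upper Matuszewska index of a distribution function $F$ with everywhere positive tail by \[ J_F^+=-\lim_{y\to\infty}\frac{1}{\log y}\log\Bigl(\liminf_{x\to\infty}\frac{\overline F(xy)}{\overline F(x)}\Bigr)\in[0,\infty]. \] Let $S_0=0$ and $S_n=\xi_1+\cdots+\xi_n$ for $n\ge 1$, and let $S_{(\eta)}=\max\{S_0,S_1,\ldots,S_\eta\}$. Suppose that (a) $F_{\xi_k}\in\mathcal{C}$ for every $k\ge 1$; (b) $\displaystyle\limsup_{x\to\infty}\ \sup_{n\ge 1}\ \frac{1}{n\,\overline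 F_{\xi_1}(x)}\sum_{k=1}^{n}\overline F_{\xi_k}(x)<\infty$; (c) $\mathbb{E}\,\eta^{p+1}<\infty$ for some real $p>J^+_{F_{\xi_1}}$. Then $F_{S_{(\eta)}}\in\mathcal{C}$. -/

import Mathlib

open Filter Topology MeasureTheory ProbabilityTheory
open scoped ENNReal

/-- The tail `1 - F` of a distribution function `F`. -/
def dfTail (F : ℝ → ℝ) (x : ℝ) : ℝ := 1 - F x

/-- The class of distribution functions with consistently varying tail:
the tail is positive everywhere (so that the quotients make sense), and
`lim_{y ↑ 1} limsup_{x → ∞} tail(x y) / tail(x) = 1`.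
The upper limit is taken in `[0, ∞]`. -/
def ConsistentlyVarying (F : ℝ → ℝ) : Prop :=
  (∀ x, 0 < dfTail F x) ∧
    Tendsto (fun y : ℝ =>
      limsup (fun x : ℝ => ENNReal.ofReal (dfTail F (x * y) / dfTail F x)) atTop)
      (𝓝[<] 1) (𝓝 1)

/-- `liminf_{x → ∞} tail(x y) / tail(x)`, an element of `[0, ∞]`. -/
noncomputable def lowerTailRatio (F : ℝ → ℝ) (y : ℝ) : ℝ≥0∞ :=
  liminf (fun x : ℝ => ENNReal.ofReal (dfTail F (x * y) / dfTail F x)) atTop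

/-- The upper Matuszewska index
`-lim_{y → ∞} (1 / log y) * log (liminf_{x → ∞} tail(x y) / tail(x))`,
an extended real number, with `log 0 = -∞`. The limit always exists for a distribution function
with positive tail, see `tendsto_upperMatuszewskaIndex`. -/
noncomputable def upperMatuszewskaIndex (F : ℝ → ℝ) : EReal :=
  -limUnder atTop
    (fun y : ℝ => ((1 / Real.log y : ℝ) : EReal) * ENNReal.log (lowerTailRatio F y))

theorem lowerTailRatio_antitone {F : ℝ → ℝ} (hF : Monotone F) (hpos : ∀ x, 0 < dfTail F x)
    {y z : ℝ} (hyz : y ≤ z) : lowerTailRatio F z ≤ lowerTailRatio F y := by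
  refine liminf_le_liminf ?_
  filter_upwards [eventually_ge_atTop (0 : ℝ)] with x hx
  refine ENNReal.ofReal_le_ofReal (div_le_div_of_nonneg_right ?_ (hpos x).le)
  have := hF (mul_le_mul_of_nonneg_left hyz hx)
  unfold dfTail
  linarith

theorem lowerTailRatio_one {F : ℝ → ℝ} (hpos : ∀ x, 0 < dfTail F x) :
    lowerTailRatio F 1 = 1 := by
  have h : ∀ x, dfTail F x / dfTail F x = 1 := fun x => div_self (hpos x).ne'
  simp [lowerTailRatio, h]

theorem lowerTailRatio_mul {F : ℝ → ℝ} (hpos : ∀ x, 0 < dfTail F x)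
    {y z : ℝ} (hz : 0 < z) :
    lowerTailRatio F y * lowerTailRatio F z ≤ lowerTailRatio F (y * z) := by
  have h1 : lowerTailRatio F y ≤
      liminf (fun x : ℝ => ENNReal.ofReal (dfTail F (x * z * y) / dfTail F (x * z))) atTop := by
    have ht : Tendsto (fun x : ℝ => x * z) atTop atTop := tendsto_id.atTop_mul_const hz
    have := liminf_le_liminf_of_le
      (u := fun x : ℝ => ENNReal.ofReal (dfTail F (x * y) / dfTail F x)) ht
    rw [← Filter.liminf_comp] at this
    exact this
  refine (mul_le_mul_left h1 _).trans (ENNReal.le_liminf_mul.trans (le_of_eq ?_))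
  refine congrArg (fun u => liminf u atTop) (funext fun x => ?_)
  rw [Pi.mul_apply, ← ENNReal.ofReal_mul (div_nonneg (hpos _).le (hpos _).le),
    div_mul_div_cancel₀ (hpos _).ne']
  ring_nf

theorem lowerTailRatio_pow {F : ℝ → ℝ} (hpos : ∀ x, 0 < dfTail F x)
    {z : ℝ} (hz : 0 < z) (n : ℕ) : lowerTailRatio F z ^ n ≤ lowerTailRatio F (z ^ n) := by
  induction n with
  | zero => simp [lowerTailRatio_one hpos]
  | succ n ih =>
    rw [pow_succ, pow_succ]
    exact (mul_le_mul_left ih _).trans (lowerTailRatio_mul hpos hz)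

/-- The limit in the definition of the upper Matuszewska index exists. -/
theorem tendsto_upperMatuszewskaIndex {F : ℝ → ℝ} (hF : Monotone F)
    (hpos : ∀ x, 0 < dfTail F x) :
    Tendsto (fun y : ℝ => ((1 / Real.log y : ℝ) : EReal) * ENNReal.log (lowerTailRatio F y))
      atTop (𝓝 (-upperMatuszewskaIndex F)) := by
  have key : ∀ z : ℝ, 1 < z →
      ((1 / Real.log z : ℝ) : EReal) * ENNReal.log (lowerTailRatio F z) ≤
        liminf (fun y : ℝ =>
          ((1 / Real.log y : ℝ) : EReal) * ENNReal.log (lowerTailRatio F y)) atTop := by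
    intro z hz
    have hlz : 0 < Real.log z := Real.log_pos hz
    have hle : lowerTailRatio F z ≤ 1 :=
      (lowerTailRatio_antitone hF hpos hz.le).trans (lowerTailRatio_one hpos).le
    by_cases h0 : lowerTailRatio F z = 0
    · rw [h0, ENNReal.log_zero, EReal.coe_mul_bot_of_pos (by positivity)]
      exact bot_le
    have htop : lowerTailRatio F z ≠ ⊤ := (hle.trans_lt ENNReal.one_lt_top).ne
    set l : ℝ := Real.log (lowerTailRatio F z).toReal with hl
    have hlog : ENNReal.log (lowerTailRatio F z) = (l : EReal) := ENNReal.log_pos_real h0 htop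
    have hl0 : l ≤ 0 := by
      have : ENNReal.log (lowerTailRatio F z) ≤ 0 := ENNReal.log_le_zero_iff.2 hle
      rw [hlog] at this
      exact_mod_cast this
    have hlim : Tendsto (fun y : ℝ => (((1 / Real.log z + 1 / Real.log y) * l : ℝ) : EReal))
        atTop (𝓝 ((1 / Real.log z * l : ℝ) : EReal)) := by
      refine (continuous_coe_real_ereal.tendsto _).comp ?_
      have h : Tendsto (fun y : ℝ => 1 / Real.log y) atTop (𝓝 0) := by
        simp only [one_div]
        exact Real.tendsto_log_atTop.inv_tendsto_atTop
      simpa using (h.const_add (1 / Real.log z)).mul_const l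
    rw [hlog, ← EReal.coe_mul, ← hlim.liminf_eq]
    refine liminf_le_liminf ?_
    filter_upwards [eventually_gt_atTop (1 : ℝ)] with y hy
    have hly : 0 < Real.log y := Real.log_pos hy
    set n : ℕ := ⌈Real.log y / Real.log z⌉₊ with hn
    have hn1 : Real.log y / Real.log z ≤ n := Nat.le_ceil _
    have hn2 : (n : ℝ) < Real.log y / Real.log z + 1 := Nat.ceil_lt_add_one (by positivity)
    have hyz : y ≤ z ^ n := by
      rw [← Real.log_le_log_iff (by positivity) (by positivity), Real.log_pow]
      exact (div_le_iff₀ hlz).1 hn1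
    have h1 : lowerTailRatio F z ^ n ≤ lowerTailRatio F y :=
      (lowerTailRatio_pow hpos (by positivity) n).trans (lowerTailRatio_antitone hF hpos hyz)
    have h2 : (((n : ℝ) * l : ℝ) : EReal) ≤ ENNReal.log (lowerTailRatio F y) := by
      have := ENNReal.log_monotone h1
      rw [ENNReal.log_pow, hlog] at this
      simpa using this
    have h3 : (((1 / Real.log y) * ((n : ℝ) * l) : ℝ) : EReal) ≤
        ((1 / Real.log y : ℝ) : EReal) * ENNReal.log (lowerTailRatio F y) := by
      rw [EReal.coe_mul]
      exact mul_le_mul_of_nonneg_left h2 (by exact_mod_cast (by positivity))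
    refine le_trans ?_ h3
    rw [EReal.coe_le_coe_iff]
    have h4 : (Real.log y / Real.log z + 1) * l ≤ n * l :=
      mul_le_mul_of_nonpos_right hn2.le hl0
    calc (1 / Real.log z + 1 / Real.log y) * l
        = 1 / Real.log y * ((Real.log y / Real.log z + 1) * l) := by field_simp
      _ ≤ 1 / Real.log y * (n * l) := mul_le_mul_of_nonneg_left h4 (by positivity)
  have hex : ∃ a : EReal, Tendsto (fun y : ℝ =>
      ((1 / Real.log y : ℝ) : EReal) * ENNReal.log (lowerTailRatio F y)) atTop (𝓝 a) := by
    refine ⟨_, tendsto_of_le_liminf_of_limsup_le le_rfl ?_⟩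
    refine limsup_le_of_le ?_ ?_
    · isBoundedDefault
    · filter_upwards [eventually_gt_atTop (1 : ℝ)] with z hz using key z hz
  rw [upperMatuszewskaIndex, neg_neg]
  exact tendsto_nhds_limUnder hex

section RandomVariables

variable {Ω : Type*} [MeasurableSpace Ω]

/-- The distribution function of a real random variable `X`. -/
noncomputable def distFun (P : Measure Ω) (X : Ω → ℝ) : ℝ → ℝ := fun x => cdf (P.map X) x

/-- `S_n = X_1 + ⋯ + X_n`, where `X_{k+1}` is `ξ k`. -/
def partialSum (ξ : ℕ → Ω → ℝ) (n : ℕ) (ω : Ω) : ℝ := ∑ k ∈ Finset.range n, ξ k ω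

/-- `max {S_0, S_1, …, S_n}`. -/
noncomputable def maxPartialSum (ξ : ℕ → Ω → ℝ) (n : ℕ) (ω : Ω) : ℝ :=
  (Finset.range (n + 1)).sup' Finset.nonempty_range_add_one (fun m => partialSum ξ m ω)

/-- `max {S_0, S_1, …, S_η}`. -/
noncomputable def stoppedMaxSum (ξ : ℕ → Ω → ℝ) (η : Ω → ℕ) (ω : Ω) : ℝ :=
  maxPartialSum ξ (η ω) ω

end RandomVariables

/-!
Write `M_n = max {S_0, …, S_n}`, `f_k` for the tail of `ξ k` and `t_n` for the tail of `M_n`. For a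
distribution function with positive tail `f`, consistent variation amounts to: for every `ε > 0`
and all `y < 1` close to `1`, `f (x y) ≤ (1 + ε) f x` for all large `x` (`NearOneStable`); the
matching lower bound is monotonicity. This form passes to finite families at once.

* *Each `M_n` has this property*, by induction on `n` (`nearOneStable_dfTail_maxPartialSum`). The
  sum exceeds a high level essentially through a single large term: since `M_n` and `ξ n` are
  independent, `t_{n+1} x` is at most `t_n (w x) + f_n (w x)` plus the probability that both `M_n`
  and `ξ n` exceed `(1 - w) x`, which is negligible as `f_n ((1 - w) x) = O(f_n x)`. It is at
  least `t_n x + (1 - o(1)) f_n (x / w)`, because `M_n ≤ x` and `S_n ≥ x - x / w` hold with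
  probability tending to one.

* *The tails of `M_n` are controlled polynomially in `n`*
  (`exists_dfTail_maxPartialSum_le_rpow`): `t_n x ≤ K n ^ (p + 1) f_0 x` for all `n ≥ 1` and all
  `x` beyond a threshold independent of `n`. If `M_n > x`, some `ξ k` exceeds `x / n`; the
  averaged tail bound `hb` bounds the sum of these probabilities by a multiple of
  `n f_0 (x / n)`, and since `p` exceeds the upper Matuszewska index of `ξ 0`, the Potter-type
  bound `f_0 x ≤ C v ^ p f_0 (x v)` (`exists_le_rpow_mul_of_upperMatuszewskaIndex_lt`) costs
  another factor `n ^ p`. If `x / n` is too small for `hb` to apply, the same bound,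
  started at a fixed point, shows that `n ^ p f_0 x` is bounded below.

By independence the tail of the randomly stopped maximum is `∑ P(η = n) t_n`. The part `n < N` is a
finite combination of stable tails; the part `n ≥ N` is at most `δ_N f_0 x` with `δ_N → 0` by the
moment hypothesis on `η`, and is negligible because the whole tail is at least `P(η = m) f_0 x`
for some `m ≥ 1` with `P(η = m) > 0`.
-/

/-! ### Consistent variation of tails -/

/-- The `ε`-form of `lim_{y ↑ 1} limsup_{x → ∞} f (x y) / f x ≤ 1`. It avoids quotients, so that it
also makes sense for tails that vanish, such as that of `max {S_0} = 0`. -/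
def NearOneStable (f : ℝ → ℝ) : Prop :=
  ∀ ε > 0, ∀ᶠ y in 𝓝[<] (1 : ℝ), ∀ᶠ x in atTop, f (x * y) ≤ (1 + ε) * f x

theorem eventually_mem_Ioo_nhdsLT_one : ∀ᶠ y in 𝓝[<] (1 : ℝ), y ∈ Set.Ioo (0 : ℝ) 1 :=
  Ioo_mem_nhdsLT one_pos

theorem ConsistentlyVarying.nearOneStable {F : ℝ → ℝ} (hF : ConsistentlyVarying F) :
    NearOneStable (dfTail F) := by
  intro ε hε
  have h1 : (1 : ℝ≥0∞) < ENNReal.ofReal (1 + ε) := by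
    rw [← ENNReal.ofReal_one]
    exact (ENNReal.ofReal_lt_ofReal_iff (by linarith)).2 (by linarith)
  filter_upwards [hF.2.eventually_lt_const h1] with y hy
  filter_upwards [eventually_lt_of_limsup_lt hy] with x hx
  have := (ENNReal.ofReal_lt_ofReal_iff (by linarith)).1 hx
  exact ((div_lt_iff₀ (hF.1 x)).1 this).le

theorem NearOneStable.consistentlyVarying {F : ℝ → ℝ} (hF : Monotone F)
    (hpos : ∀ x, 0 < dfTail F x) (h : NearOneStable (dfTail F)) : ConsistentlyVarying F := by
  refine ⟨hpos, ?_⟩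
  have hge : ∀ᶠ y in 𝓝[<] (1 : ℝ), 1 ≤
      limsup (fun x : ℝ => ENNReal.ofReal (dfTail F (x * y) / dfTail F x)) atTop := by
    filter_upwards [eventually_mem_Ioo_nhdsLT_one] with y hy
    refine le_limsup_of_frequently_le (Eventually.frequently ?_) (by isBoundedDefault)
    filter_upwards [eventually_ge_atTop (0 : ℝ)] with x hx
    rw [← ENNReal.ofReal_one]
    refine ENNReal.ofReal_le_ofReal ((one_le_div (hpos x)).2 ?_)
    have := hF (mul_le_of_le_one_right hx hy.2.le)
    unfold dfTail
    linarith
  refine tendsto_order.2 ⟨fun a ha => ?_, fun a ha => ?_⟩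
  · filter_upwards [hge] with y hy using ha.trans_le hy
  · obtain ⟨b, hb1, hba⟩ := exists_between ha
    have hbt : b ≠ ⊤ := (hba.trans_le le_top).ne
    have hb' : 1 < b.toReal := by
      rw [← ENNReal.toReal_one]
      exact (ENNReal.toReal_lt_toReal ENNReal.one_ne_top hbt).2 hb1
    filter_upwards [h (b.toReal - 1) (by linarith)] with y hy
    refine lt_of_le_of_lt (limsup_le_of_le (by isBoundedDefault) ?_) hba
    filter_upwards [hy] with x hx
    refine ENNReal.ofReal_le_of_le_toReal ((div_le_iff₀ (hpos x)).2 ?_)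
    linarith

/-- Consistent variation implies dominated variation: iterate the defining bound for one fixed `y`
until `y ^ n < s`. -/
theorem NearOneStable.exists_le_mul {f : ℝ → ℝ} (hf : NearOneStable f) (hanti : Antitone f)
    {s : ℝ} (hs : 0 < s) : ∃ D, 0 < D ∧ ∀ᶠ x in atTop, f (x * s) ≤ D * f x := by
  obtain ⟨y, hy, hy01⟩ := ((hf 1 one_pos).and eventually_mem_Ioo_nhdsLT_one).exists
  have hpow : ∀ n : ℕ, ∀ᶠ x in atTop, f (x * y ^ n) ≤ (1 + 1) ^ n * f x := by
    intro n
    induction n with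
    | zero => simp
    | succ n ih =>
      have ht : Tendsto (fun x : ℝ => x * y ^ n) atTop atTop :=
        tendsto_id.atTop_mul_const (pow_pos hy01.1 n)
      filter_upwards [ih, ht.eventually hy] with x h1 h2
      rw [pow_succ, ← mul_assoc]
      refine h2.trans ?_
      rw [pow_succ]
      nlinarith
  obtain ⟨n, hn⟩ := exists_pow_lt_of_lt_one hs hy01.2
  refine ⟨(1 + 1) ^ n, by positivity, ?_⟩
  filter_upwards [hpow n, eventually_ge_atTop 0] with x h1 h2
  exact (hanti (mul_le_mul_of_nonneg_left hn.le h2)).trans h1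

/-- The analytic part of the induction step for maxima of sums. Here `a` is the tail of the maximum
so far, `b` the tail of the new term, `s` the tail of minus the sum so far, and `t` the tail of the
new maximum. Comparing both bounds at `x w` and `x` respectively, the shifts of the arguments
amount to at most a factor `w ^ 3`. -/
theorem NearOneStable.of_single_jump_bounds {a b s t : ℝ → ℝ} (ha : NearOneStable a)
    (hb : NearOneStable b) (ha_anti : Antitone a) (hb_anti : Antitone b)
    (ha0 : ∀ x, 0 ≤ a x) (hb0 : ∀ x, 0 ≤ b x)
    (ha_lim : Tendsto a atTop (𝓝 0)) (hs_lim : Tendsto s atTop (𝓝 0))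
    (hupper : ∀ w ∈ Set.Ioo (0 : ℝ) 1, ∀ x, 0 < x →
      t x ≤ a (x * w) + b (x * w) + a (x * (1 - w)) * b (x * (1 - w)))
    (hlower : ∀ w ∈ Set.Ioo (0 : ℝ) 1, ∀ x,
      a x + (1 - a x - s (x / w - x)) * b (x / w) ≤ t x) :
    NearOneStable t := by
  intro ε₀ hε₀
  -- `ε` is chosen so that `1 + 2 ε ≤ (1 + ε₀) (1 - ε)`.
  obtain ⟨ε, hε, hεε⟩ : ∃ ε : ℝ, 0 < ε ∧ 1 + 2 * ε ≤ (1 + ε₀) * (1 - ε) := by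
    refine ⟨ε₀ / (3 + ε₀), by positivity, le_of_eq ?_⟩
    field_simp
    ring
  have hcube : Tendsto (fun w : ℝ => w ^ 3) (𝓝[<] 1) (𝓝[<] 1) := by
    refine tendsto_nhdsWithin_iff.2 ⟨?_, ?_⟩
    · have : Tendsto (fun w : ℝ => w ^ 3) (𝓝 1) (𝓝 (1 ^ 3)) := (continuous_pow 3).tendsto 1
      rw [one_pow] at this
      exact this.mono_left nhdsWithin_le_nhds
    · filter_upwards [eventually_mem_Ioo_nhdsLT_one] with w hw
      exact pow_lt_one₀ hw.1.le hw.2 (by norm_num)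
  filter_upwards [hcube.eventually (ha ε hε), hcube.eventually (hb ε hε),
    eventually_mem_Ioo_nhdsLT_one] with w haw hbw hw
  have h1w : 0 < 1 - w := sub_pos.2 hw.2
  obtain ⟨D, hD, hbD⟩ := hb.exists_le_mul hb_anti
    (s := w ^ 2 * (1 - w)) (mul_pos (pow_pos hw.1 2) h1w)
  have hdiv : Tendsto (fun x : ℝ => x / w) atTop atTop := tendsto_id.atTop_div_const hw.1
  have hmul : Tendsto (fun x : ℝ => x * w * (1 - w)) atTop atTop :=
    (tendsto_id.atTop_mul_const hw.1).atTop_mul_const h1w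
  have hgap : Tendsto (fun x : ℝ => x / w - x) atTop atTop := by
    have : (fun x : ℝ => x / w - x) = fun x => x * (w⁻¹ - 1) := by ext x; ring
    rw [this]
    exact tendsto_id.atTop_mul_const (sub_pos.2 ((one_lt_inv₀ hw.1).2 hw.2))
  filter_upwards [haw, hdiv.eventually hbw, hdiv.eventually hbD, eventually_gt_atTop 0,
    (ha_lim.comp hmul).eventually_le_const (show 0 < ε / D by positivity),
    ha_lim.eventually_le_const (show 0 < ε / 2 by positivity),
    (hs_lim.comp hgap).eventually_le_const (show 0 < ε / 2 by positivity)]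
    with x hax hbx hDx hx ha1 ha2 hs1
  simp only [Function.comp_apply] at ha1 hs1
  have hwne := hw.1.ne'
  have e1 : x / w * w ^ 3 = x * w * w := by field_simp
  have e2 : x / w * (w ^ 2 * (1 - w)) = x * w * (1 - w) := by field_simp
  rw [e1] at hbx
  rw [e2] at hDx
  have hup := hupper w hw (x * w) (mul_pos hx hw.1)
  have hlo := hlower w hw x
  have hA : a (x * w * w) ≤ (1 + ε) * a x := by
    refine (ha_anti ?_).trans hax
    have : w ^ 3 ≤ w * w := by
      nlinarith [mul_pos (mul_pos hw.1 hw.1) h1w]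
    nlinarith
  have hprod : a (x * w * (1 - w)) * b (x * w * (1 - w)) ≤ ε * b (x / w) := by
    calc _ ≤ (ε / D) * (D * b (x / w)) :=
          mul_le_mul ha1 hDx (hb0 _) (by positivity)
      _ = ε * b (x / w) := by field_simp
  have hB := hb0 (x / w)
  have hA0 := ha0 x
  calc t (x * w) ≤ (1 + 2 * ε) * (a x + b (x / w)) := by nlinarith
    _ ≤ (1 + ε₀) * (1 - ε) * (a x + b (x / w)) :=
        mul_le_mul_of_nonneg_right hεε (by positivity)
    _ = (1 + ε₀) * ((1 - ε) * (a x + b (x / w))) := by ring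
    _ ≤ (1 + ε₀) * t x := by
        refine mul_le_mul_of_nonneg_left (le_trans ?_ hlo) (by linarith)
        nlinarith

/-! ### A Potter-type bound -/

/-- If `p` exceeds the upper Matuszewska index, then `f x ≤ y ^ p f (x y)` for one `y > 1` and all
large `x`; iterating this along powers of `y` gives the bound for all factors `v ≥ 1`. The index is
nonnegative, whence `0 < p`. -/
theorem exists_le_rpow_mul_of_upperMatuszewskaIndex_lt {F : ℝ → ℝ} (hF : Monotone F)
    (hpos : ∀ x, 0 < dfTail F x) {p : ℝ} (hp : upperMatuszewskaIndex F < p) :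
    0 < p ∧ ∃ C > 0, ∃ x₀, ∀ x ≥ x₀, ∀ v ≥ 1, dfTail F x ≤ C * v ^ p * dfTail F (x * v) := by
  have hlt : -(p : EReal) < -upperMatuszewskaIndex F := EReal.neg_lt_neg_iff.2 hp
  obtain ⟨y, hy, hy1⟩ := (((tendsto_upperMatuszewskaIndex hF hpos).eventually_const_lt hlt).and
    (eventually_gt_atTop (1 : ℝ))).exists
  have hly : 0 < Real.log y := Real.log_pos hy1
  have hy0 : 0 < y := one_pos.trans hy1
  have hL : ENNReal.ofReal (y ^ (-p)) < lowerTailRatio F y := by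
    rw [← ENNReal.log_lt_log_iff, ENNReal.log_ofReal_of_pos (Real.rpow_pos_of_pos hy0 _),
      Real.log_rpow hy0]
    by_contra! hcon
    refine absurd hy (not_lt.2 ?_)
    calc ((1 / Real.log y : ℝ) : EReal) * ENNReal.log (lowerTailRatio F y)
        ≤ ((1 / Real.log y : ℝ) : EReal) * ((-p * Real.log y : ℝ) : EReal) :=
          mul_le_mul_of_nonneg_left hcon (by exact_mod_cast (by positivity))
      _ = -(p : EReal) := by
          rw [← EReal.coe_mul, ← EReal.coe_neg]
          congr 1
          field_simp
  have hp0 : 0 < p := by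
    have hle : lowerTailRatio F y ≤ 1 :=
      (lowerTailRatio_antitone hF hpos hy1.le).trans (lowerTailRatio_one hpos).le
    have h := ENNReal.ofReal_lt_one.1 (hL.trans_le hle)
    rw [Real.rpow_lt_one_iff_of_pos hy0] at h
    rcases h with h | h <;> linarith
  refine ⟨hp0, ?_⟩
  obtain ⟨x₁, hx₁⟩ := eventually_atTop.1 (eventually_lt_of_lt_liminf hL)
  have hstep : ∀ x ≥ x₁, dfTail F x ≤ y ^ p * dfTail F (x * y) := by
    intro x hx
    have h := (ENNReal.ofReal_lt_ofReal_iff_of_nonneg (by positivity)).1 (hx₁ x hx)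
    rw [lt_div_iff₀ (hpos x), Real.rpow_neg hy0.le, inv_mul_lt_iff₀ (by positivity)] at h
    exact h.le
  refine ⟨y ^ p, by positivity, max x₁ 0, fun x hx v hv => ?_⟩
  have hx1 : x₁ ≤ x := (le_max_left _ _).trans hx
  have hx0 : 0 ≤ x := (le_max_right _ _).trans hx
  have hpow : ∀ k : ℕ, dfTail F x ≤ (y ^ k) ^ p * dfTail F (x * y ^ k) := by
    intro k
    induction k with
    | zero => simp
    | succ k ih =>
      have h1 : x₁ ≤ x * y ^ k :=
        hx1.trans (le_mul_of_one_le_right hx0 (one_le_pow₀ hy1.le))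
      calc dfTail F x ≤ (y ^ k) ^ p * dfTail F (x * y ^ k) := ih
        _ ≤ (y ^ k) ^ p * (y ^ p * dfTail F (x * y ^ k * y)) :=
            mul_le_mul_of_nonneg_left (hstep _ h1) (by positivity)
        _ = (y ^ (k + 1)) ^ p * dfTail F (x * y ^ (k + 1)) := by
            rw [pow_succ, Real.mul_rpow (by positivity) hy0.le, mul_assoc, mul_assoc]
  obtain ⟨k, hk1, hk2⟩ := exists_nat_pow_near hv hy1
  have hmono : dfTail F (x * y ^ (k + 1)) ≤ dfTail F (x * v) :=
    sub_le_sub_left (hF (mul_le_mul_of_nonneg_left hk2.le hx0)) _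
  calc dfTail F x ≤ (y ^ (k + 1)) ^ p * dfTail F (x * y ^ (k + 1)) := hpow _
    _ ≤ (y * v) ^ p * dfTail F (x * v) := by
        refine mul_le_mul ?_ hmono (hpos _).le (by positivity)
        refine Real.rpow_le_rpow (by positivity) ?_ hp0.le
        rw [pow_succ, mul_comm]
        exact mul_le_mul_of_nonneg_left hk1 hy0.le
    _ = y ^ p * v ^ p * dfTail F (x * v) := by
        rw [Real.mul_rpow hy0.le (by linarith)]

/-! ### Tails of random variables -/

section Tails

variable {Ω : Type*} [MeasurableSpace Ω]

theorem dfTail_distFun {P : Measure Ω} [IsProbabilityMeasure P] {X : Ω → ℝ} (hX : Measurable X)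
    (x : ℝ) : dfTail (distFun P X) x = P.real {ω | x < X ω} := by
  have := Measure.isProbabilityMeasure_map (μ := P) hX.aemeasurable
  rw [dfTail, distFun, cdf_eq_real, map_measureReal_apply hX measurableSet_Iic,
    ← probReal_compl_eq_one_sub (hX measurableSet_Iic)]
  congr 1
  ext ω
  simp

theorem monotone_distFun (P : Measure Ω) (X : Ω → ℝ) : Monotone (distFun P X) :=
  monotone_cdf _

theorem antitone_dfTail {F : ℝ → ℝ} (hF : Monotone F) : Antitone (dfTail F) :=
  fun _ _ h => sub_le_sub_left (hF h) _

theorem dfTail_distFun_nonneg (P : Measure Ω) (X : Ω → ℝ) (x : ℝ) : 0 ≤ dfTail (distFun P X) x :=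
  sub_nonneg.2 (cdf_le_one _ _)

theorem dfTail_distFun_le_one (P : Measure Ω) (X : Ω → ℝ) (x : ℝ) : dfTail (distFun P X) x ≤ 1 :=
  sub_le_self _ (cdf_nonneg _ _)

theorem tendsto_dfTail_distFun (P : Measure Ω) (X : Ω → ℝ) :
    Tendsto (dfTail (distFun P X)) atTop (𝓝 0) := by
  have h := (tendsto_cdf_atTop (P.map X)).const_sub 1
  rwa [sub_self] at h

end Tails

/-! ### Maxima of partial sums -/

section MaxSums

variable {Ω : Type*}

theorem partialSum_succ (ξ : ℕ → Ω → ℝ) (n : ℕ) (ω : Ω) :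
    partialSum ξ (n + 1) ω = partialSum ξ n ω + ξ n ω :=
  Finset.sum_range_succ _ _

theorem lt_maxPartialSum_iff {ξ : ℕ → Ω → ℝ} {n : ℕ} {ω : Ω} {x : ℝ} :
    x < maxPartialSum ξ n ω ↔ ∃ m ≤ n, x < partialSum ξ m ω := by
  simp [maxPartialSum, Finset.lt_sup'_iff]

theorem maxPartialSum_zero (ξ : ℕ → Ω → ℝ) (ω : Ω) : maxPartialSum ξ 0 ω = 0 := by
  simp [maxPartialSum, partialSum]

theorem partialSum_le_maxPartialSum (ξ : ℕ → Ω → ℝ) {m n : ℕ} (h : m ≤ n) (ω : Ω) :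
    partialSum ξ m ω ≤ maxPartialSum ξ n ω :=
  Finset.le_sup' (fun m => partialSum ξ m ω) (Finset.mem_range_succ_iff.2 h)

theorem lt_maxPartialSum_succ_iff {ξ : ℕ → Ω → ℝ} {n : ℕ} {ω : Ω} {x : ℝ} :
    x < maxPartialSum ξ (n + 1) ω ↔
      x < maxPartialSum ξ n ω ∨ x < partialSum ξ n ω + ξ n ω := by
  rw [← partialSum_succ, lt_maxPartialSum_iff, lt_maxPartialSum_iff]
  constructor
  · rintro ⟨m, hm, h⟩
    rcases Nat.le_succ_iff.1 hm with hm | rfl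
    · exact .inl ⟨m, hm, h⟩
    · exact .inr h
  · rintro (⟨m, hm, h⟩ | h)
    · exact ⟨m, hm.trans n.le_succ, h⟩
    · exact ⟨n + 1, le_rfl, h⟩

/-- For `n = 0` the hypothesis fails, as `max {S_0} = 0`. -/
theorem exists_div_lt_of_lt_maxPartialSum {ξ : ℕ → Ω → ℝ} {n : ℕ} {ω : Ω} {x : ℝ} (hx : 0 ≤ x)
    (h : x < maxPartialSum ξ n ω) : ∃ k < n, x / n < ξ k ω := by
  obtain ⟨m, hm, h⟩ := lt_maxPartialSum_iff.1 h
  by_contra! hcon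
  refine h.not_ge ?_
  calc partialSum ξ m ω ≤ ∑ _k ∈ Finset.range m, x / n :=
        Finset.sum_le_sum fun k hk => hcon k ((Finset.mem_range.1 hk).trans_le hm)
    _ = m * (x / n) := by simp
    _ ≤ n * (x / n) := by gcongr
    _ ≤ x := by
        rcases Nat.eq_zero_or_pos n with rfl | hn
        · simpa using hx
        · exact (mul_div_cancel₀ x (by positivity)).le

variable [MeasurableSpace Ω]

theorem measurable_partialSum {ξ : ℕ → Ω → ℝ} (hξ : ∀ k, Measurable (ξ k)) (n : ℕ) :
    Measurable (partialSum ξ n) :=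
  Finset.measurable_fun_sum _ fun k _ => hξ k

theorem measurable_maxPartialSum {ξ : ℕ → Ω → ℝ} (hξ : ∀ k, Measurable (ξ k)) (n : ℕ) :
    Measurable (maxPartialSum ξ n) := by
  have := Finset.measurable_sup' (f := fun m => partialSum ξ m)
    (Finset.nonempty_range_add_one (n := n)) fun m _ => measurable_partialSum hξ m
  convert this using 1
  ext ω
  simp [maxPartialSum, Finset.sup'_apply]

theorem measurable_stoppedMaxSum {ξ : ℕ → Ω → ℝ} {η : Ω → ℕ} (hξ : ∀ k, Measurable (ξ k))
    (hη : Measurable η) : Measurable (stoppedMaxSum ξ η) := by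
  have h : Measurable (fun q : Ω × ℕ => maxPartialSum ξ q.2 q.1) :=
    measurable_from_prod_countable_left fun n => measurable_maxPartialSum hξ n
  exact h.comp (measurable_id.prodMk hη)

/-! ### Tails of maxima of independent sums -/

theorem indepFun_maxPartialSum_partialSum {P : Measure Ω} {ξ : ℕ → Ω → ℝ}
    (hξ : ∀ k, Measurable (ξ k)) (hind : iIndepFun ξ P) (n : ℕ) :
    IndepFun (fun ω => (maxPartialSum ξ n ω, partialSum ξ n ω)) (ξ n) P := by
  -- `M_n` and `S_n` are measurable functions of the finite tuple of the first `n` terms: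
  -- they are `maxPartialSum` and `partialSum` of the coordinates `g`, padded by zero.
  let g : ℕ → (Finset.range n → ℝ) → ℝ :=
    fun k z => if h : k ∈ Finset.range n then z ⟨k, h⟩ else 0
  have hg : ∀ k, Measurable (g k) := by
    intro k
    by_cases h : k ∈ Finset.range n
    · simp only [g, dif_pos h]
      exact measurable_pi_apply _
    · simp only [g, dif_neg h]
      exact measurable_const
  have hsum : ∀ m ≤ n, ∀ ω, partialSum g m (fun i : Finset.range n => ξ i ω) =
      partialSum ξ m ω := by
    intro m hm ω
    refine Finset.sum_congr rfl fun k hk => ?_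
    have : k < n := (Finset.mem_range.1 hk).trans_le hm
    simp [g, this]
  have hmax : ∀ ω, maxPartialSum g n (fun i : Finset.range n => ξ i ω) = maxPartialSum ξ n ω := by
    intro ω
    exact Finset.sup'_congr _ rfl fun m hm => hsum m (Finset.mem_range_succ_iff.1 hm) ω
  have h := (hind.indepFun_finset (Finset.range n) {n} (by simp) hξ).comp
    ((measurable_maxPartialSum hg n).prodMk (measurable_partialSum hg n))
    (measurable_pi_apply (⟨n, Finset.mem_singleton_self n⟩ : ({n} : Finset ℕ)))
  convert h using 1
  · ext ω : 1
    simp [hmax, hsum n le_rfl]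
  · rfl

theorem ProbabilityTheory.IndepFun.measureReal_inter_preimage_eq_mul {P : Measure Ω}
    {α β : Type*} [MeasurableSpace α] [MeasurableSpace β] {X : Ω → α} {Y : Ω → β}
    (h : IndepFun X Y P) {A : Set α} {B : Set β}
    (hA : MeasurableSet A) (hB : MeasurableSet B) :
    P.real (X ⁻¹' A ∩ Y ⁻¹' B) = P.real (X ⁻¹' A) * P.real (Y ⁻¹' B) := by
  simp only [measureReal_def, h.measure_inter_preimage_eq_mul _ _ hA hB, ENNReal.toReal_mul]

/-- If `M_{n+1} > x` while `M_n` and `ξ n` are both at most `x w`, then `S_n + ξ n > x` forces each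
of them above `x (1 - w)`. -/
theorem dfTail_maxPartialSum_succ_le {P : Measure Ω} [IsProbabilityMeasure P] {ξ : ℕ → Ω → ℝ}
    (hξ : ∀ k, Measurable (ξ k)) (hind : iIndepFun ξ P) (n : ℕ) {w : ℝ}
    (hw : w ∈ Set.Ioo (0 : ℝ) 1) {x : ℝ} (hx : 0 < x) :
    dfTail (distFun P (maxPartialSum ξ (n + 1))) x ≤
      dfTail (distFun P (maxPartialSum ξ n)) (x * w) + dfTail (distFun P (ξ n)) (x * w) +
        dfTail (distFun P (maxPartialSum ξ n)) (x * (1 - w)) *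
          dfTail (distFun P (ξ n)) (x * (1 - w)) := by
  simp only [dfTail_distFun (measurable_maxPartialSum hξ _), dfTail_distFun (hξ n)]
  have hprod := ((indepFun_maxPartialSum_partialSum hξ hind n).comp measurable_fst
    measurable_id).measureReal_inter_preimage_eq_mul (measurableSet_Ioi (a := x * (1 - w)))
      (measurableSet_Ioi (a := x * (1 - w)))
  refine le_trans ?_ (add_le_add (measureReal_union_le _ _) hprod.le)
  refine (measureReal_mono ?_).trans (measureReal_union_le _ _)
  intro ω hω
  simp only [Set.mem_ofPred_eq, Set.mem_union, Set.mem_inter_iff, Set.mem_preimage,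
    Function.comp_apply, id_eq, Set.mem_Ioi] at hω ⊢
  by_contra! hcon
  obtain ⟨⟨h1, h2⟩, h3⟩ := hcon
  have hxw : x * w < x := mul_lt_of_lt_one_right hx hw.2
  rcases lt_maxPartialSum_succ_iff.1 hω with h | h
  · linarith
  · have hS := partialSum_le_maxPartialSum ξ (le_refl n) ω
    have := h3 (by linarith)
    linarith

/-- Disjointly from `M_n > x`, the maximum exceeds `x` at time `n + 1` if `M_n ≤ x`, `S_n ≥ x - y`
and `ξ n > y`. -/
theorem le_dfTail_maxPartialSum_succ {P : Measure Ω} [IsProbabilityMeasure P] {ξ : ℕ → Ω → ℝ}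
    (hξ : ∀ k, Measurable (ξ k)) (hind : iIndepFun ξ P) (n : ℕ) (x y : ℝ) :
    dfTail (distFun P (maxPartialSum ξ n)) x +
        (1 - dfTail (distFun P (maxPartialSum ξ n)) x -
          dfTail (distFun P (fun ω => -partialSum ξ n ω)) (y - x)) * dfTail (distFun P (ξ n)) y ≤
      dfTail (distFun P (maxPartialSum ξ (n + 1))) x := by
  have hM := measurable_maxPartialSum hξ n
  have hS := measurable_partialSum hξ n
  simp only [dfTail_distFun (measurable_maxPartialSum hξ _), dfTail_distFun (hξ n),
    dfTail_distFun hS.fun_neg]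
  set A : Set (ℝ × ℝ) := {q | q.1 ≤ x ∧ x - y ≤ q.2} with hA
  have hAm : MeasurableSet A :=
    (measurableSet_le measurable_fst measurable_const).inter
      (measurableSet_le measurable_const measurable_snd)
  have hprod := (indepFun_maxPartialSum_partialSum hξ hind n).measureReal_inter_preimage_eq_mul hAm
    (measurableSet_Ioi (a := y))
  set Z : Ω → ℝ × ℝ := fun ω => (maxPartialSum ξ n ω, partialSum ξ n ω) with hZ
  have hZm : Measurable Z := hM.prodMk hS
  have hlow : 1 - P.real {ω | x < maxPartialSum ξ n ω} - P.real {ω | y - x < -partialSum ξ n ω} ≤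
      P.real (Z ⁻¹' A) := by
    have h1 : P.real (Z ⁻¹' A)ᶜ ≤
        P.real {ω | x < maxPartialSum ξ n ω} + P.real {ω | y - x < -partialSum ξ n ω} := by
      refine (measureReal_mono fun ω hω => ?_).trans (measureReal_union_le _ _)
      simp only [Set.mem_compl_iff, Set.mem_preimage, hA, hZ, Set.mem_ofPred_eq, not_and_or,
        not_le] at hω
      exact hω.imp id fun h => show y - x < -partialSum ξ n ω by linarith
    rw [probReal_compl_eq_one_sub (hZm hAm)] at h1
    linarith
  have hdisj : Disjoint {ω | x < maxPartialSum ξ n ω} (Z ⁻¹' A ∩ ξ n ⁻¹' Set.Ioi y) := by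
    refine Set.disjoint_left.2 fun ω h1 h2 => ?_
    exact (h2.1.1 : maxPartialSum ξ n ω ≤ x).not_gt h1
  refine (add_le_add_right (mul_le_mul_of_nonneg_right hlow measureReal_nonneg) _).trans ?_
  change _ + P.real (Z ⁻¹' A) * P.real (ξ n ⁻¹' Set.Ioi y) ≤ _
  rw [← hprod, ← measureReal_union hdisj ((hZm hAm).inter (hξ n measurableSet_Ioi))]
  refine measureReal_mono fun ω hω => lt_maxPartialSum_succ_iff.2 ?_
  refine hω.imp id fun h => ?_
  have h1 : x - y ≤ partialSum ξ n ω := h.1.2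
  have h2 : y < ξ n ω := h.2
  linarith

theorem nearOneStable_dfTail_maxPartialSum {P : Measure Ω} [IsProbabilityMeasure P]
    {ξ : ℕ → Ω → ℝ} (hξ : ∀ k, Measurable (ξ k)) (hind : iIndepFun ξ P)
    (hstab : ∀ k, NearOneStable (dfTail (distFun P (ξ k)))) (n : ℕ) :
    NearOneStable (dfTail (distFun P (maxPartialSum ξ n))) := by
  induction n with
  | zero =>
    intro ε hε
    filter_upwards [eventually_mem_Ioo_nhdsLT_one] with y hy
    filter_upwards [eventually_ge_atTop 0] with x hx
    have h0 : ∀ z : ℝ, 0 ≤ z → dfTail (distFun P (maxPartialSum ξ 0)) z = 0 := by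
      intro z hz
      rw [dfTail_distFun (measurable_maxPartialSum hξ 0)]
      simp [maxPartialSum_zero, hz.not_gt]
    rw [h0 _ hx, h0 _ (mul_nonneg hx hy.1.le), mul_zero]
  | succ n ih =>
    exact ih.of_single_jump_bounds (hstab n) (antitone_dfTail (monotone_distFun _ _))
      (antitone_dfTail (monotone_distFun _ _)) (dfTail_distFun_nonneg _ _)
      (dfTail_distFun_nonneg _ _) (tendsto_dfTail_distFun _ _)
      (tendsto_dfTail_distFun P fun ω => -partialSum ξ n ω)
      (fun w hw x hx => dfTail_maxPartialSum_succ_le hξ hind n hw hx)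
      (fun w _ x => le_dfTail_maxPartialSum_succ hξ hind n x (x / w))

theorem dfTail_maxPartialSum_le_sum {P : Measure Ω} [IsProbabilityMeasure P] {ξ : ℕ → Ω → ℝ}
    (hξ : ∀ k, Measurable (ξ k)) (n : ℕ) {x : ℝ} (hx : 0 ≤ x) :
    dfTail (distFun P (maxPartialSum ξ n)) x ≤
      ∑ k ∈ Finset.range n, dfTail (distFun P (ξ k)) (x / n) := by
  simp only [dfTail_distFun (measurable_maxPartialSum hξ _), dfTail_distFun (hξ _)]
  refine (measureReal_mono (fun ω hω => ?_) (measure_ne_top _ _)).trans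
    (measureReal_biUnion_finset_le _ _)
  obtain ⟨k, hk, h⟩ := exists_div_lt_of_lt_maxPartialSum hx hω
  exact Set.mem_biUnion (Finset.mem_coe.2 (Finset.mem_range.2 hk)) h

theorem dfTail_le_dfTail_maxPartialSum {P : Measure Ω} [IsProbabilityMeasure P] {ξ : ℕ → Ω → ℝ}
    (hξ : ∀ k, Measurable (ξ k)) {n : ℕ} (hn : 1 ≤ n) (x : ℝ) :
    dfTail (distFun P (ξ 0)) x ≤ dfTail (distFun P (maxPartialSum ξ n)) x := by
  rw [dfTail_distFun (measurable_maxPartialSum hξ _), dfTail_distFun (hξ _)]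
  refine measureReal_mono fun ω (hω : x < ξ 0 ω) => ?_
  refine lt_maxPartialSum_iff.2 ⟨1, hn, ?_⟩
  simpa [partialSum] using hω

/-- A bound on the tail of `M_n` that is uniform in `n` beyond a common threshold for `x`. -/
theorem exists_dfTail_maxPartialSum_le_rpow {P : Measure Ω} [IsProbabilityMeasure P]
    {ξ : ℕ → Ω → ℝ} (hξ : ∀ k, Measurable (ξ k)) (hpos : ∀ x, 0 < dfTail (distFun P (ξ 0)) x)
    (hb : limsup (fun x : ℝ => ⨆ (n : ℕ) (_ : 1 ≤ n),
        ENNReal.ofReal (1 / (n * dfTail (distFun P (ξ 0)) x) *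
          ∑ k ∈ Finset.range n, dfTail (distFun P (ξ k)) x)) atTop < ⊤)
    {p : ℝ} (hp : upperMatuszewskaIndex (distFun P (ξ 0)) < p) :
    ∃ K, 0 < K ∧ ∀ᶠ x in atTop, ∀ n, 1 ≤ n →
      dfTail (distFun P (maxPartialSum ξ n)) x ≤
        K * (n : ℝ) ^ (p + 1) * dfTail (distFun P (ξ 0)) x := by
  obtain ⟨hp0, C, hC, x₁, hpotter⟩ :=
    exists_le_rpow_mul_of_upperMatuszewskaIndex_lt (monotone_distFun P (ξ 0)) hpos hp
  obtain ⟨B, hB1, hB2⟩ := exists_between hb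
  obtain ⟨x₂, hx₂⟩ := eventually_atTop.1 (eventually_lt_of_limsup_lt hB1)
  set x₀ := max (max x₁ x₂) 1 with hx₀
  have h1 : x₁ ≤ x₀ := (le_max_left _ _).trans (le_max_left _ _)
  have h2 : x₂ ≤ x₀ := (le_max_right _ _).trans (le_max_left _ _)
  have h3 : 0 < x₀ := one_pos.trans_le (le_max_right _ _)
  have hsum : ∀ x ≥ x₀, ∀ n : ℕ, 1 ≤ n → ∑ k ∈ Finset.range n, dfTail (distFun P (ξ k)) x ≤
      B.toReal * (n * dfTail (distFun P (ξ 0)) x) := by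
    intro x hx n hn
    have hn0 : (0 : ℝ) < n := by exact_mod_cast hn
    have h := (le_iSup₂ (f := fun (n : ℕ) (_ : 1 ≤ n) =>
      ENNReal.ofReal (1 / (n * dfTail (distFun P (ξ 0)) x) *
          ∑ k ∈ Finset.range n, dfTail (distFun P (ξ k)) x)) n hn).trans
      (hx₂ x (h2.trans hx)).le
    rw [ENNReal.ofReal_le_iff_le_toReal hB2.ne, one_div_mul_eq_div,
      div_le_iff₀ (mul_pos hn0 (hpos x))] at h
    exact h
  set d := dfTail (distFun P (ξ 0)) x₀ with hd
  have hd0 : 0 < d := hpos x₀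
  refine ⟨B.toReal * C + C / d, by positivity, ?_⟩
  filter_upwards [eventually_ge_atTop x₀] with x hx n hn
  have hn1 : (1 : ℝ) ≤ n := by exact_mod_cast hn
  have hn0 : (0 : ℝ) < n := by linarith
  have hx0 : 0 < x := h3.trans_le hx
  have hf := hpos x
  have hnp : (n : ℝ) ^ (p + 1) = n ^ p * n := by rw [Real.rpow_add hn0, Real.rpow_one]
  have hB0 : 0 ≤ B.toReal := ENNReal.toReal_nonneg
  rcases le_or_gt x₀ (x / n) with hcase | hcase
  · have hpn := hpotter (x / n) (h1.trans hcase) n hn1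
    rw [div_mul_cancel₀ x hn0.ne'] at hpn
    calc dfTail (distFun P (maxPartialSum ξ n)) x
        ≤ ∑ k ∈ Finset.range n, dfTail (distFun P (ξ k)) (x / n) :=
          dfTail_maxPartialSum_le_sum hξ n hx0.le
      _ ≤ B.toReal * (n * dfTail (distFun P (ξ 0)) (x / n)) := hsum _ hcase n hn
      _ ≤ B.toReal * (n * (C * n ^ p * dfTail (distFun P (ξ 0)) x)) := by gcongr
      _ = B.toReal * C * n ^ (p + 1) * dfTail (distFun P (ξ 0)) x := by rw [hnp]; ring
      _ ≤ _ := by gcongr; exact le_add_of_nonneg_right (by positivity)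
  -- Here `n > x / x₀`, so already `n ^ p * f_0 x` is bounded below.
  · have hv : 1 ≤ x / x₀ := (one_le_div h3).2 hx
    have hvn : x / x₀ ≤ n := by
      rw [div_le_iff₀ h3]
      rw [div_lt_iff₀ hn0] at hcase
      linarith
    have hpn := hpotter x₀ h1 (x / x₀) hv
    rw [mul_div_cancel₀ x h3.ne', ← hd] at hpn
    calc dfTail (distFun P (maxPartialSum ξ n)) x ≤ 1 := dfTail_distFun_le_one _ _ _
      _ = d / d := (div_self hd0.ne').symm
      _ ≤ (C * (x / x₀) ^ p * dfTail (distFun P (ξ 0)) x) / d := by gcongr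
      _ ≤ (C * (n ^ p * n) * dfTail (distFun P (ξ 0)) x) / d := by
          gcongr
          exact (Real.rpow_le_rpow (by positivity) hvn hp0.le).trans
            (le_mul_of_one_le_right (by positivity) hn1)
      _ = C / d * n ^ (p + 1) * dfTail (distFun P (ξ 0)) x := by rw [hnp]; ring
      _ ≤ _ := by gcongr; exact le_add_of_nonneg_left (by positivity)

/-! ### Random stopping -/

theorem hasSum_dfTail_stoppedMaxSum {P : Measure Ω} [IsProbabilityMeasure P] {ξ : ℕ → Ω → ℝ}
    {η : Ω → ℕ} (hξ : ∀ k, Measurable (ξ k)) (hη : Measurable η)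
    (hind : IndepFun η (fun ω k => ξ k ω) P) (x : ℝ) :
    HasSum (fun n => P.real (η ⁻¹' {n}) * dfTail (distFun P (maxPartialSum ξ n)) x)
      (dfTail (distFun P (stoppedMaxSum ξ η)) x) := by
  -- `M_n` is `maxPartialSum` of the coordinates, evaluated at the sequence `ξ`.
  have hmeas : ∀ n, MeasurableSet {z : ℕ → ℝ | x < maxPartialSum (fun k z => z k) n z} := fun n =>
    measurableSet_lt measurable_const (measurable_maxPartialSum (fun k => measurable_pi_apply k) n)
  have hterm : ∀ n, P.real (η ⁻¹' {n}) * dfTail (distFun P (maxPartialSum ξ n)) x =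
      P.real (η ⁻¹' {n} ∩ {ω | x < stoppedMaxSum ξ η ω}) := by
    intro n
    rw [dfTail_distFun (measurable_maxPartialSum hξ n)]
    refine (hind.measureReal_inter_preimage_eq_mul (measurableSet_singleton n)
      (hmeas n)).symm.trans ?_
    congr 1
    ext ω
    refine and_congr_right fun h => ?_
    have h' : η ω = n := h
    change x < maxPartialSum ξ n ω ↔ x < maxPartialSum ξ (η ω) ω
    rw [h']
  have hms : MeasurableSet {ω | x < stoppedMaxSum ξ η ω} :=
    measurableSet_lt measurable_const (measurable_stoppedMaxSum hξ hη)
  have hset : {ω | x < stoppedMaxSum ξ η ω} =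
      ⋃ n, η ⁻¹' {n} ∩ {ω | x < stoppedMaxSum ξ η ω} := by
    ext ω
    simp
  have hunion := measure_iUnion (μ := P)
    (f := fun n => η ⁻¹' {n} ∩ {ω | x < stoppedMaxSum ξ η ω})
    (fun i j hij => ((Set.disjoint_singleton.2 hij).preimage η).mono
      Set.inter_subset_left Set.inter_subset_left)
    fun n => (hη (measurableSet_singleton n)).inter hms
  rw [← hset] at hunion
  rw [funext hterm, dfTail_distFun (measurable_stoppedMaxSum hξ hη)]
  simp only [measureReal_def]
  rw [hunion, ENNReal.tsum_toReal_eq fun n => measure_ne_top _ _]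
  exact (ENNReal.summable_toReal (hunion ▸ measure_ne_top _ _)).hasSum

theorem summable_measureReal_mul_of_lintegral_lt_top {P : Measure Ω} {η : Ω → ℕ}
    (hη : Measurable η) {g : ℕ → ℝ} (hg : ∀ n, 0 ≤ g n)
    (h : ∫⁻ ω, ENNReal.ofReal (g (η ω)) ∂P < ⊤) :
    Summable fun n => P.real (η ⁻¹' {n}) * g n := by
  rw [← lintegral_map (f := fun n => ENNReal.ofReal (g n)) (measurable_of_countable _) hη,
    lintegral_countable'] at h
  refine (ENNReal.summable_toReal h.ne).congr fun n => ?_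
  rw [Measure.map_apply hη (measurableSet_singleton n), ENNReal.toReal_mul,
    ENNReal.toReal_ofReal (hg n), measureReal_def, mul_comm]

end MaxSums

theorem theorem5 {Ω : Type*} [MeasurableSpace Ω] (P : Measure Ω) [IsProbabilityMeasure P]
    (ξ : ℕ → Ω → ℝ) (η : Ω → ℕ)
    (hξ_meas : ∀ k, Measurable (ξ k)) (hη_meas : Measurable η)
    (hξ_indep : iIndepFun ξ P)
    (hηξ_indep : IndepFun η (fun ω k => ξ k ω) P)
    (hη_nondeg : P {ω | η ω = 0} ≠ 1)
    (ha : ∀ k, ConsistentlyVarying (distFun P (ξ k)))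
    (hb : limsup (fun x : ℝ => ⨆ (n : ℕ) (_ : 1 ≤ n),
        ENNReal.ofReal (1 / (n * dfTail (distFun P (ξ 0)) x) *
          ∑ k ∈ Finset.range n, dfTail (distFun P (ξ k)) x)) atTop < ⊤)
    (hc : ∃ p : ℝ, upperMatuszewskaIndex (distFun P (ξ 0)) < (p : EReal) ∧
        ∫⁻ ω, ENNReal.ofReal ((η ω : ℝ) ^ (p + 1)) ∂P < ⊤) :
    ConsistentlyVarying (distFun P (stoppedMaxSum ξ η)) := by
  obtain ⟨p, hp, hmoment⟩ := hc
  have hpos := (ha 0).1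
  obtain ⟨m, hm1, hqm⟩ : ∃ m, 1 ≤ m ∧ 0 < P.real (η ⁻¹' {m}) := by
    by_contra! hcon
    refine hη_nondeg ((prob_compl_eq_zero_iff (hη_meas (measurableSet_singleton 0))).1 ?_)
    refine measure_mono_null (t := ⋃ m : ℕ, η ⁻¹' {m + 1}) (fun ω hω => ?_)
      (measure_iUnion_null fun m => ?_)
    · exact Set.mem_iUnion.2 ⟨η ω - 1, (Nat.succ_pred hω).symm⟩
    · exact (measureReal_eq_zero_iff).1 (le_antisymm (hcon (m + 1) (by omega)) measureReal_nonneg)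
  have hT := hasSum_dfTail_stoppedMaxSum hξ_meas hη_meas hηξ_indep
  set q : ℕ → ℝ := fun n => P.real (η ⁻¹' {n}) with hq
  set t : ℕ → ℝ → ℝ := fun n => dfTail (distFun P (maxPartialSum ξ n)) with ht
  set T : ℝ → ℝ := dfTail (distFun P (stoppedMaxSum ξ η)) with hTdef
  set f : ℝ → ℝ := dfTail (distFun P (ξ 0)) with hf
  have hq0 : ∀ n, 0 ≤ q n := fun n => measureReal_nonneg
  have ht0 : ∀ n x, 0 ≤ t n x := fun n x => dfTail_distFun_nonneg _ _ _
  have hTf : ∀ x, q m * f x ≤ T x := fun x =>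
    (mul_le_mul_of_nonneg_left (dfTail_le_dfTail_maxPartialSum hξ_meas hm1 x) (hq0 m)).trans
      (le_hasSum (hT x) m fun n _ => mul_nonneg (hq0 n) (ht0 n x))
  obtain ⟨K, hK, hbound⟩ := exists_dfTail_maxPartialSum_le_rpow hξ_meas hpos hb hp
  have hsummable : Summable fun n : ℕ => q n * (n : ℝ) ^ (p + 1) :=
    summable_measureReal_mul_of_lintegral_lt_top hη_meas (g := fun n => (n : ℝ) ^ (p + 1))
      (fun n => by positivity) hmoment
  refine NearOneStable.consistentlyVarying (monotone_distFun _ _)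
    (fun x => (mul_pos hqm (hpos x)).trans_le (hTf x)) fun ε₀ hε₀ => ?_
  -- `ε` is chosen so that `(1 + ε) ^ 2 ≤ 1 + ε₀`.
  obtain ⟨ε, hε, hεε⟩ : ∃ ε : ℝ, 0 < ε ∧ (1 + ε) * (1 + ε) ≤ 1 + ε₀ := by
    refine ⟨√(1 + ε₀) - 1, sub_pos.2 (Real.lt_sqrt_of_sq_lt (by linarith)), ?_⟩
    rw [add_sub_cancel, Real.mul_self_sqrt (by linarith)]
  -- The part `n ≥ N` is at most `ε * q m * f`, which `hTf` absorbs into `ε * T`. Taking `N ≥ 1`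
  -- keeps `n = 0` out of the range of the bound `hbound`.
  obtain ⟨N, hN1, hN⟩ : ∃ N : ℕ, 1 ≤ N ∧
      K * ∑' n, q (n + N) * ((n + N : ℕ) : ℝ) ^ (p + 1) ≤ ε * q m := by
    have h := (tendsto_sum_nat_add fun n : ℕ => q n * (n : ℝ) ^ (p + 1)).const_mul K
    rw [mul_zero] at h
    obtain ⟨N, h1, h2⟩ := ((h.eventually_le_const (mul_pos hε hqm)).and
      (eventually_ge_atTop 1)).exists
    exact ⟨N, h2, h1⟩
  have hstab : ∀ n, NearOneStable (t n) := nearOneStable_dfTail_maxPartialSum hξ_meas hξ_indep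
    fun k => (ha k).nearOneStable
  filter_upwards [(ha 0).nearOneStable ε hε,
    (Finset.range N).eventually_all.2 fun n _ => hstab n ε hε, eventually_mem_Ioo_nhdsLT_one]
    with w hfw htw hw
  have hmul : Tendsto (fun x : ℝ => x * w) atTop atTop := tendsto_id.atTop_mul_const hw.1
  filter_upwards [hfw, (Finset.range N).eventually_all.2 htw, hmul.eventually hbound]
    with x hfx htx hbx
  have hhead : ∑ n ∈ Finset.range N, q n * t n (x * w) ≤ (1 + ε) * T x := by
    calc ∑ n ∈ Finset.range N, q n * t n (x * w)
        ≤ ∑ n ∈ Finset.range N, (1 + ε) * (q n * t n x) := Finset.sum_le_sum fun n hn => by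
          nlinarith [mul_le_mul_of_nonneg_left (htx n hn) (hq0 n)]
      _ = (1 + ε) * ∑ n ∈ Finset.range N, q n * t n x := by rw [Finset.mul_sum]
      _ ≤ (1 + ε) * T x := mul_le_mul_of_nonneg_left
          (sum_le_hasSum _ (fun n _ => mul_nonneg (hq0 n) (ht0 n x)) (hT x)) (by linarith)
  have htail : ∑' n, q (n + N) * t (n + N) (x * w) ≤ ε * ((1 + ε) * T x) := by
    have hs := (summable_nat_add_iff N).2 hsummable
    calc ∑' n, q (n + N) * t (n + N) (x * w)
        ≤ ∑' n, K * f (x * w) * (q (n + N) * ((n + N : ℕ) : ℝ) ^ (p + 1)) := by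
          refine ((summable_nat_add_iff N).2 (hT (x * w)).summable).tsum_le_tsum (fun n => ?_)
            (hs.mul_left _)
          calc q (n + N) * t (n + N) (x * w)
              ≤ q (n + N) * (K * ((n + N : ℕ) : ℝ) ^ (p + 1) * f (x * w)) :=
                mul_le_mul_of_nonneg_left (hbx (n + N) (by omega)) (hq0 _)
            _ = _ := by ring
      _ = K * (∑' n, q (n + N) * ((n + N : ℕ) : ℝ) ^ (p + 1)) * f (x * w) := by
          rw [tsum_mul_left]; ring
      _ ≤ ε * q m * f (x * w) := mul_le_mul_of_nonneg_right hN (hpos _).le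
      _ ≤ ε * q m * ((1 + ε) * f x) :=
          mul_le_mul_of_nonneg_left hfx (mul_nonneg hε.le (hq0 m))
      _ = ε * ((1 + ε) * (q m * f x)) := by ring
      _ ≤ ε * ((1 + ε) * T x) := by
          have := hTf x
          gcongr
  have hT0 : 0 ≤ T x := dfTail_distFun_nonneg _ _ _
  calc T (x * w) = ∑ n ∈ Finset.range N, q n * t n (x * w) +
        ∑' n, q (n + N) * t (n + N) (x * w) := by
        rw [(hT (x * w)).summable.sum_add_tsum_nat_add N, (hT (x * w)).tsum_eq]
    _ ≤ (1 + ε) * T x + ε * ((1 + ε) * T x) := add_le_add hhead htail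
    _ = (1 + ε) * (1 + ε) * T x := by ring
    _ ≤ (1 + ε₀) * T x := mul_le_mul_of_nonneg_right hεε hT0
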